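/- Let $n\ge 0$ be the horizon and $K\ge 1$ the number of arms. A stochastic bandit environment consists of means $\mu\in\mathbb R^K$ with $\mu_i-\mu_j\le 1$ for all $i,j$ and, for each arm $i$, a $1$-subgaussian noise distribution $P_i$ on $\mathbb R$, that is, $\int e^{\lambda x}\,dP_i(x)\le e^{\lambda^2/2}$ for all $\lambda\in\mathbb R$. In round $t\in\{1,\dots,n\}$ a strategy $\pi$ chooses an arm $I_t\in\{1,\dots,K\}$ as a (measurable) function of the actions and rewards of the previous rounds, and receives the reward $\mu_{I_t}+\eta_t$, where, given the past and $I_t$, the noise $\eta_t$ has law $P_{I_t}$. The worst-case expected pseudo-regret of $\pi$ with respect to arm $i$ is $$R^\pi_i=\sup\Big(n\mu_i-\mathbb E\sum_{t=1}^n\mu_{I_t}\Big),$$ where the supremum is over all such environments. Let $$\mathcal B=\Big\{B\in[0,n]^K:\ B_i\ge\min\Big\{n,\ \sum_{j\ne i}\frac{n}{B_j}\Big\}\text{ for all }i\Big\},$$ where $n/0=\infty$ for $n>0$ and $0/0=0$. Let $B\in\mathcal B$ and $n_i=n^2/B_i^2$. Unbalanced MOSS with input $n$ and $B$ is a strategy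 which in each round $t=1,\dots,n$ chooses $$I_t\in\operatorname*{arg\,max}_i\ \hat\mu_i(t-1)+\sqrt{\frac{4}{T_i(t-1)}\log_+\!\Big(\frac{n_i}{T_i(t-1)}\Big)}-\sqrt{\frac1{n_i}},$$ with ties broken in an arbitrary (measurable) way, where $T_i(t-1)$ is the number of times that arm $i$ was chosen in the first $t-1$ rounds, $\hat\mu_i(t-1)$ is the average of the rewards received from it in these rounds, $\log_+(x)=\max\{0,\log x\}$, and the index of an arm with $T_i(t-1)=0$ is $+\infty$. Such strategies exist, and every such strategy $\pi$ satisfies $$R^\pi_i\le 252\,B_i\qquad\text{for every arm } i\in\{1,\dots,K\}.$$ -/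

import Mathlib

open MeasureTheory ProbabilityTheory
open scoped ENNReal

namespace Bandit

/-- The actions played and the rewards received in the first `t` rounds, in order. -/
abbrev History (K t : ℕ) : Type := Fin t → Fin K × ℝ

/-- A bandit strategy with `K` arms: a (measurable) function from histories to actions.
`act t h` is the action played in the round that follows the `t` rounds recorded in `h`. -/
structure Strategy (K : ℕ) where
  act : (t : ℕ) → History K t → Fin K
  measurable_act : ∀ t, Measurable (act t)

/-- A stochastic bandit with `K` arms: playing arm `i` yields the reward `mean i + η`, where the
noise `η` is drawn from the `1`-subgaussian law `noise i`. All gaps are at most one. -/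
structure Environment (K : ℕ) where
  mean : Fin K → ℝ
  noise : Fin K → Measure ℝ
  isProbabilityMeasure_noise : ∀ i, IsProbabilityMeasure (noise i)
  subgaussian_noise : ∀ i, HasSubgaussianMGF (fun x : ℝ => x) 1 (noise i)
  gap_le_one : ∀ i j, mean i - mean j ≤ 1

/-- The law of the history of the first `t` rounds when `π` interacts with `ν`: given the history
`h` so far, the arm `π.act t h` is played and fresh noise with the law of this arm is drawn. -/
noncomputable def historyLaw {K : ℕ} (π : Strategy K) (ν : Environment K) :
    (t : ℕ) → Measure (History K t)
  | 0 => Measure.dirac Fin.elim0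
  | t + 1 => (historyLaw π ν t).bind fun h =>
      (ν.noise (π.act t h)).map fun η =>
        (Fin.snoc h (π.act t h, ν.mean (π.act t h) + η) : History K (t + 1))

/-- The expected pseudo-regret over `n` rounds with respect to arm `i`,
`n μ_i - E ∑_{t ≤ n} μ_{I_t}`. -/
noncomputable def regret {K : ℕ} (n : ℕ) (π : Strategy K) (ν : Environment K) (i : Fin K) : ℝ :=
  n * ν.mean i - ∫ h, ∑ t : Fin n, ν.mean (h t).1 ∂(historyLaw π ν n)

/-- The worst-case expected pseudo-regret with respect to arm `i` (a supremum in the extended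
reals). -/
noncomputable def worstCaseRegret {K : ℕ} (n : ℕ) (π : Strategy K) (i : Fin K) : EReal :=
  ⨆ ν : Environment K, (regret n π ν i : EReal)

/-- The set `𝓑` of all `B ∈ [0, n]^K` with `B_i ≥ min {n, ∑_{j ≠ i} n / B_j}` for all `i`. The
inequality is read in `[0, ∞]`, so that `n / 0 = ∞` when `0 < n`. -/
def frontierSet (n K : ℕ) : Set (Fin K → ℝ) :=
  {B | (∀ i, B i ∈ Set.Icc (0 : ℝ) n) ∧
    ∀ i, min (n : ℝ≥0∞) (∑ j ∈ Finset.univ.erase i, (n : ℝ≥0∞) / ENNReal.ofReal (B j))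
      ≤ ENNReal.ofReal (B i)}

/-- `T_i`: the number of plays of arm `i` in the history `h`. -/
def playCount {K t : ℕ} (h : History K t) (i : Fin K) : ℕ :=
  (Finset.univ.filter fun s => (h s).1 = i).card

/-- The average of the rewards of arm `i` in the history `h`, which is `0` if there are none. -/
noncomputable def empiricalMean {K t : ℕ} (h : History K t) (i : Fin K) : ℝ :=
  (∑ s ∈ Finset.univ.filter (fun s => (h s).1 = i), (h s).2) / (playCount h i : ℝ)

/-- `n_i = n² / B_i²`. -/
noncomputable def armHorizon {K : ℕ} (n : ℕ) (B : Fin K → ℝ) (i : Fin K) : ℝ :=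
  (n : ℝ) ^ 2 / B i ^ 2

/-- The index of arm `i` after the history `h`. It is infinite for an arm that has not been played
yet, since the width of its confidence interval is infinite. -/
noncomputable def mossIndex {K t : ℕ} (n : ℕ) (B : Fin K → ℝ) (h : History K t) (i : Fin K) :
    EReal :=
  if playCount h i = 0 then ⊤
  else ((empiricalMean h i
    + √(4 / (playCount h i : ℝ) * Real.posLog (armHorizon n B i / (playCount h i : ℝ)))
    - √(1 / armHorizon n B i) : ℝ) : EReal)

/-- `π` is Unbalanced MOSS with input `n` and `B`: in each of the `n` rounds it plays an arm of
largest index. Ties may be broken in any way. -/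
def IsUnbalancedMOSS {K : ℕ} (n : ℕ) (B : Fin K → ℝ) (π : Strategy K) : Prop :=
  ∀ t < n, ∀ (h : History K t) (j : Fin K), mossIndex n B h j ≤ mossIndex n B h (π.act t h)

end Bandit

namespace Bandit

/-! Write `N j` for `armHorizon n B j`, `b j = √(1 / N j)`, and let `V` be a random bound on how far
the upper confidence bounds of the comparison arm `i` ever fall below its mean. Arms with gap at
most `D = 2 * (V + b i)` cost at most `n * D` in total. If arm `j` has a larger gap and is chosen,
comparing its index with that of `i` forces its confidence bound above its mean by at least `x = gap
/ 2 + b j`. Each play count allows at most one such round, so the plays of `j` are at most 1 plus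
the number of counts at which this deviation occurs.

Two tail estimates finish the argument. Dyadic peeling (`real_occurs_lowerDeviation_le`) bounds a
shortfall of size `x` by `16 / (N i * x ^ 2)`, so `V` has mean at most `33 * b i`. The expected
number of upper deviations times `x` is at most `4 * √(N j) + 8 / x`
(`mul_sum_real_occurs_upperDeviation_le`), which is of order `√(N j)` because `x ≥ b j`. Both rest
on Ville's inequality for exponential supermartingales.

Since `n * b i = B i` and `√(N j) = n / B j`, the regret is of order `B i + ∑ n / B j` over `j ≠ i`.
When `B i < n`, membership in the frontier set bounds this sum by `B i`. -/

variable {K : ℕ}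

/-! ### Measurability of one round and integration against the history law. -/

theorem measurable_snoc_reward (π : Strategy K) (ν : Environment K) (t : ℕ) :
    Measurable fun p : History K t × ℝ =>
      (Fin.snoc p.1 (π.act t p.1, ν.mean (π.act t p.1) + p.2) : History K (t + 1)) := by
  have hact : Measurable fun p : History K t × ℝ => π.act t p.1 :=
    (π.measurable_act t).comp measurable_fst
  have hmean : Measurable fun p : History K t × ℝ => ν.mean (π.act t p.1) :=
    (measurable_of_countable ν.mean).comp hact
  refine measurable_pi_lambda _ fun s => ?_
  refine Fin.lastCases ?_ (fun s => ?_) s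
  · simpa using hact.prodMk (hmean.add measurable_snd)
  · simpa [Function.comp_def] using (measurable_pi_apply s).comp measurable_fst

theorem measurable_snoc_reward_right (π : Strategy K) (ν : Environment K) {t : ℕ}
    (h : History K t) :
    Measurable fun η : ℝ =>
      (Fin.snoc h (π.act t h, ν.mean (π.act t h) + η) : History K (t + 1)) :=
  (measurable_snoc_reward π ν t).comp measurable_prodMk_left

theorem measurable_step (π : Strategy K) (ν : Environment K) (t : ℕ) :
    Measurable fun h : History K t =>
      (ν.noise (π.act t h)).map fun η =>
        (Fin.snoc h (π.act t h, ν.mean (π.act t h) + η) : History K (t + 1)) := by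
  have hκ : Measurable fun h : History K t => ν.noise (π.act t h) :=
    (measurable_of_countable ν.noise).comp (π.measurable_act t)
  let κ : Kernel (History K t) ℝ := ⟨_, hκ⟩
  have : IsMarkovKernel κ := ⟨fun h => ν.isProbabilityMeasure_noise _⟩
  refine Measure.measurable_of_measurable_coe _ fun s hs => ?_
  have key := Kernel.measurable_kernel_prodMk_left (κ := κ) (measurable_snoc_reward π ν t hs)

  convert key using 2 with h
  rw [Measure.map_apply (measurable_snoc_reward_right π ν h) hs]
  rfl

theorem lintegral_historyLaw_succ (π : Strategy K) (ν : Environment K) (t : ℕ)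
    {f : History K (t + 1) → ℝ≥0∞} (hf : Measurable f) :
    ∫⁻ h, f h ∂historyLaw π ν (t + 1) =
      ∫⁻ h, ∫⁻ η, f (Fin.snoc h (π.act t h, ν.mean (π.act t h) + η)) ∂ν.noise (π.act t h)
        ∂historyLaw π ν t := by
  rw [historyLaw, Measure.lintegral_bind (measurable_step π ν t).aemeasurable hf.aemeasurable]
  refine lintegral_congr fun h => ?_
  rw [lintegral_map hf (measurable_snoc_reward_right π ν h)]

instance isProbabilityMeasure_historyLaw (π : Strategy K) (ν : Environment K) (t : ℕ) :
    IsProbabilityMeasure (historyLaw π ν t) := by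
  induction t with
  | zero => rw [historyLaw]; infer_instance
  | succ t ih =>
    constructor
    have := ν.isProbabilityMeasure_noise
    rw [← lintegral_one, lintegral_historyLaw_succ π ν t measurable_const]
    simp

/-! ### Events along initial segments and Ville's inequality. -/

/-- The first `t` rounds of a history. -/
def History.take {n : ℕ} (h : History K n) (t : ℕ) (ht : t ≤ n) : History K t :=
  fun s => h (Fin.castLE ht s)

theorem measurable_take {n : ℕ} (t : ℕ) (ht : t ≤ n) :
    Measurable fun h : History K n => h.take t ht :=
  measurable_pi_lambda _ fun _ => measurable_pi_apply _

theorem take_self {n : ℕ} (h : History K n) : h.take n le_rfl = h := rfl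

theorem take_snoc {n : ℕ} (h : History K n) (x : Fin K × ℝ) (t : ℕ) (ht : t ≤ n) :
    History.take (Fin.snoc h x : History K (n + 1)) t (ht.trans n.le_succ) = h.take t ht := by
  ext1 s
  exact Fin.snoc_castSucc (α := fun _ => Fin K × ℝ) x h (Fin.castLE ht s)

/-- The histories of which some initial segment lies in `A`. -/
def occurs (A : ∀ t, Set (History K t)) (n : ℕ) : Set (History K n) :=
  {h | ∃ t, ∃ ht : t ≤ n, h.take t ht ∈ A t}

theorem measurableSet_occurs {A : ∀ t, Set (History K t)} (hA : ∀ t, MeasurableSet (A t)) (n : ℕ) :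
    MeasurableSet (occurs A n) := by
  have : occurs A n = ⋃ t, ⋃ ht : t ≤ n, (fun h : History K n => h.take t ht) ⁻¹' A t := by
    ext h; simp [occurs]
  rw [this]
  exact .iUnion fun t => .iUnion fun ht => measurable_take t ht (hA t)

theorem snoc_mem_occurs {A : ∀ t, Set (History K t)} {n : ℕ} (h : History K n) (x : Fin K × ℝ) :
    (Fin.snoc h x : History K (n + 1)) ∈ occurs A (n + 1) ↔
      h ∈ occurs A n ∨ (Fin.snoc h x : History K (n + 1)) ∈ A (n + 1) := by
  constructor
  · rintro ⟨t, ht, hA⟩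
    rcases Nat.lt_or_ge n t with hlt | hle
    · obtain rfl : t = n + 1 := by omega
      exact .inr hA
    · rw [take_snoc h x t hle] at hA
      exact .inl ⟨t, hle, hA⟩
  · rintro (⟨t, ht, hA⟩ | hA)
    · exact ⟨t, ht.trans n.le_succ, by rwa [take_snoc h x t ht]⟩
    · exact ⟨n + 1, le_rfl, hA⟩

/-- Almost surely, the actions in the history are those of the strategy. -/
theorem ae_act_take (π : Strategy K) (ν : Environment K) (n : ℕ) :
    ∀ᵐ h ∂historyLaw π ν n, ∀ t : Fin n, (h t).1 = π.act t (h.take t t.2.le) := by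
  have hmeas : ∀ n, MeasurableSet
      {h : History K n | ∀ t : Fin n, (h t).1 = π.act t (h.take t t.2.le)} := by
    intro n
    rw [Set.ofPred_forall]
    exact .iInter fun t => measurableSet_eq_fun (measurable_pi_apply t).fst
      ((π.measurable_act t).comp (measurable_take _ _))
  induction n with
  | zero => exact .of_forall fun h t => t.elim0
  | succ n ih =>
    rw [ae_iff, ← Set.compl_ofPred, ← lintegral_indicator_one (hmeas _).compl,
      lintegral_historyLaw_succ π ν n (measurable_one.indicator (hmeas _).compl)]
    refine (lintegral_congr_ae (g := fun _ => 0) ?_).trans (by simp)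
    filter_upwards [ih] with h hh
    refine (lintegral_congr fun η => ?_).trans lintegral_zero
    refine Set.indicator_of_notMem (Set.notMem_compl_iff.2 ?_) _
    intro t
    refine Fin.lastCases ?_ (fun t => ?_) t
    · have h2 := take_snoc h (π.act n h, ν.mean (π.act n h) + η) n le_rfl
      rw [take_self] at h2
      rw [Fin.snoc_last]
      exact congrArg (π.act n) h2.symm
    · rw [Fin.snoc_castSucc, hh t]
      exact congrArg (π.act t) (take_snoc h _ t t.2.le).symm

/-- **Ville's inequality** for a nonnegative supermartingale `M` along the history. -/
theorem mul_historyLaw_occurs_le (π : Strategy K) (ν : Environment K)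
    {M : ∀ t, History K t → ℝ≥0∞} (hM : ∀ t, Measurable (M t)) (h0 : ∀ h, M 0 h ≤ 1)
    (hstep : ∀ t h, ∫⁻ η, M (t + 1) (Fin.snoc h (π.act t h, ν.mean (π.act t h) + η))
      ∂ν.noise (π.act t h) ≤ M t h)
    {A : ∀ t, Set (History K t)} (hA : ∀ t, MeasurableSet (A t)) {c : ℝ≥0∞}
    (hc : ∀ t, ∀ h ∈ A t, c ≤ M t h) (n : ℕ) :
    c * historyLaw π ν n (occurs A n) ≤ 1 := by
  classical
  have hW : ∀ t, Measurable ((occurs A t).piecewise (fun _ => c) (M t)) := fun t =>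
    measurable_const.piecewise (measurableSet_occurs hA t) (hM t)
  -- Freezing the process at the value `c` once `A` has occurred plays the role of optional
  -- stopping: the frozen process still has nonincreasing integral.
  have key : ∀ t, ∫⁻ h, (occurs A t).piecewise (fun _ => c) (M t) h ∂historyLaw π ν t ≤ 1 := by
    intro t
    induction t with
    | zero =>
      rw [historyLaw, lintegral_dirac' _ (hW 0)]
      by_cases hmem : (Fin.elim0 : History K 0) ∈ occurs A 0
      · rw [Set.piecewise_eq_of_mem _ _ _ hmem]
        obtain ⟨t, ht, hmem⟩ := hmem
        obtain rfl : t = 0 := by omega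
        exact (hc 0 _ hmem).trans (h0 _)
      · rw [Set.piecewise_eq_of_notMem _ _ _ hmem]
        exact h0 _
    | succ t ih =>
      rw [lintegral_historyLaw_succ π ν t (hW _)]
      refine (lintegral_mono fun h => ?_).trans ih
      by_cases hmem : h ∈ occurs A t
      · rw [Set.piecewise_eq_of_mem _ _ _ hmem]
        have := ν.isProbabilityMeasure_noise (π.act t h)
        refine (lintegral_congr (g := fun _ => c) fun η => ?_).trans_le (by simp)
        exact Set.piecewise_eq_of_mem _ _ _ ((snoc_mem_occurs h _).2 (.inl hmem))
      · rw [Set.piecewise_eq_of_notMem _ _ _ hmem]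
        refine (lintegral_mono fun η => ?_).trans (hstep t h)
        by_cases hmem' : (Fin.snoc h (π.act t h, ν.mean (π.act t h) + η) : History K (t + 1)) ∈
            occurs A (t + 1)
        · rw [Set.piecewise_eq_of_mem _ _ _ hmem']
          exact hc _ _ (((snoc_mem_occurs h _).1 hmem').resolve_left hmem)
        · rw [Set.piecewise_eq_of_notMem _ _ _ hmem']
  refine le_trans ?_ (key n)
  rw [← lintegral_indicator_const (measurableSet_occurs hA n)]
  refine lintegral_mono fun h => ?_
  by_cases hmem : h ∈ occurs A n <;> simp [hmem]

/-! ### Noise sums and a Chernoff bound. -/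

/-- The sum of the noise of arm `j` in the history `h`. -/
noncomputable def noiseSum (ν : Environment K) {t : ℕ} (h : History K t) (j : Fin K) : ℝ :=
  ∑ s ∈ Finset.univ.filter (fun s => (h s).1 = j), ((h s).2 - ν.mean j)

theorem playCount_snoc {t : ℕ} (h : History K t) (x : Fin K × ℝ) (j : Fin K) :
    playCount (Fin.snoc h x : History K (t + 1)) j =
      playCount h j + if x.1 = j then 1 else 0 := by
  simp only [playCount, Finset.card_filter, Fin.sum_univ_castSucc, Fin.snoc_castSucc,
    Fin.snoc_last]

theorem noiseSum_snoc (ν : Environment K) {t : ℕ} (h : History K t) (x : Fin K × ℝ) (j : Fin K) :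
    noiseSum ν (Fin.snoc h x : History K (t + 1)) j =
      noiseSum ν h j + if x.1 = j then x.2 - ν.mean j else 0 := by
  simp only [noiseSum, Finset.sum_filter, Fin.sum_univ_castSucc, Fin.snoc_castSucc,
    Fin.snoc_last]

theorem measurable_playCount {t : ℕ} (j : Fin K) :
    Measurable fun h : History K t => playCount h j := by
  simp only [playCount, Finset.card_filter]
  refine Finset.measurable_sum _ fun s _ => ?_
  exact .ite ((measurable_pi_apply s).fst (measurableSet_singleton j)) measurable_const
    measurable_const

theorem measurable_noiseSum (ν : Environment K) {t : ℕ} (j : Fin K) :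
    Measurable fun h : History K t => noiseSum ν h j := by
  simp only [noiseSum, Finset.sum_filter]
  refine Finset.measurable_sum _ fun s _ => ?_
  exact .ite ((measurable_pi_apply s).fst (measurableSet_singleton j))
    ((measurable_pi_apply s).snd.sub_const _) measurable_const

theorem measurable_empiricalMean {t : ℕ} (j : Fin K) :
    Measurable fun h : History K t => empiricalMean h j := by
  simp only [empiricalMean, Finset.sum_filter]
  refine .div (Finset.measurable_sum _ fun s _ => ?_)
    ((measurable_of_countable _).comp (measurable_playCount j))
  exact .ite ((measurable_pi_apply s).fst (measurableSet_singleton j))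
    (measurable_pi_apply s).snd measurable_const

theorem empiricalMean_eq (ν : Environment K) {t : ℕ} (h : History K t) (j : Fin K)
    (hj : playCount h j ≠ 0) :
    empiricalMean h j = ν.mean j + noiseSum ν h j / playCount h j := by
  have : (playCount h j : ℝ) ≠ 0 := by exact_mod_cast hj
  rw [empiricalMean, noiseSum, Finset.sum_sub_distrib, Finset.sum_const, nsmul_eq_mul,
    ← playCount]
  field_simp
  ring

/-- Chernoff's bound for the noise of an arm, uniformly over the rounds in which it has been played
at most `m` times. -/
theorem real_occurs_noiseSum_le (π : Strategy K) (ν : Environment K) (n : ℕ) (j : Fin K)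
    {σ m y : ℝ} (hσ : σ ^ 2 = 1) (hm : 0 < m) (hy : 0 ≤ y) :
    (historyLaw π ν n).real
      (occurs (fun _ => {h | (playCount h j : ℝ) ≤ m ∧ y ≤ σ * noiseSum ν h j}) n) ≤
      Real.exp (-(y ^ 2 / (2 * m))) := by
  -- This tilt maximises `|l| * y - l ^ 2 * m / 2`, with maximum `y ^ 2 / (2 * m)`; the sign `σ`
  -- serves both tails. On the event the supermartingale `exp (l * S - l ^ 2 * T / 2)` is at least
  -- the exponential of this maximum.
  set l : ℝ := σ * (y / m) with hl
  have hl2 : l ^ 2 = (y / m) ^ 2 := by rw [hl, mul_pow, hσ, one_mul]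
  have hville := mul_historyLaw_occurs_le π ν
    (M := fun t h => ENNReal.ofReal
      (Real.exp (l * noiseSum ν h j - l ^ 2 * playCount h j / 2)))
    (A := fun _ => {h | (playCount h j : ℝ) ≤ m ∧ y ≤ σ * noiseSum ν h j})
    (c := ENNReal.ofReal (Real.exp (y ^ 2 / (2 * m)))) ?_ ?_ ?_ ?_ ?_ n
  · rw [Real.exp_neg, ← one_div, le_div_iff₀ (Real.exp_pos _), mul_comm]
    have := ENNReal.toReal_mono ENNReal.one_ne_top hville
    rwa [ENNReal.toReal_mul, ENNReal.toReal_ofReal (Real.exp_pos _).le, ENNReal.toReal_one] at this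
  · intro t
    exact (Real.measurable_exp.comp (((measurable_noiseSum ν j).const_mul l).sub
      ((((measurable_of_countable fun k : ℕ => (k : ℝ)).comp (measurable_playCount j)).const_mul
        _).div_const 2))).ennreal_ofReal
  · intro h
    simp [noiseSum, playCount]
  · intro t h
    set a := π.act t h
    have := ν.isProbabilityMeasure_noise a
    by_cases ha : a = j
    · have hint := (ν.subgaussian_noise a).integrable_exp_mul l
      have hle := (ν.subgaussian_noise a).mgf_le l
      calc _ = ∫⁻ η, ENNReal.ofReal (Real.exp (l * noiseSum ν h j - l ^ 2 * playCount h j / 2)) *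
              (ENNReal.ofReal (Real.exp (-(l ^ 2 / 2))) * ENNReal.ofReal (Real.exp (l * η)))
              ∂ν.noise a := by
            refine lintegral_congr fun η => ?_
            rw [← ENNReal.ofReal_mul (Real.exp_pos _).le, ← ENNReal.ofReal_mul (Real.exp_pos _).le,
              ← Real.exp_add, ← Real.exp_add, playCount_snoc, noiseSum_snoc]
            simp only [ha, if_true]
            congr 2
            push_cast
            ring
        _ = ENNReal.ofReal (Real.exp (l * noiseSum ν h j - l ^ 2 * playCount h j / 2)) *
              (ENNReal.ofReal (Real.exp (-(l ^ 2 / 2))) *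
                ENNReal.ofReal (mgf (fun x => x) (ν.noise a) l)) := by
            rw [lintegral_const_mul _ (by fun_prop), lintegral_const_mul _ (by fun_prop), mgf,
              ofReal_integral_eq_lintegral_ofReal hint (.of_forall fun _ => (Real.exp_pos _).le)]
        _ ≤ ENNReal.ofReal (Real.exp (l * noiseSum ν h j - l ^ 2 * playCount h j / 2)) * 1 := by
            gcongr
            rw [← ENNReal.ofReal_mul (Real.exp_pos _).le, ENNReal.ofReal_le_one]
            calc _ ≤ Real.exp (-(l ^ 2 / 2)) * Real.exp ((1 : NNReal) * l ^ 2 / 2) := by gcongr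
              _ = 1 := by rw [← Real.exp_add]; simp
        _ = _ := mul_one _
    · simp [playCount_snoc, noiseSum_snoc, ha]
  · intro t
    exact (measurableSet_le ((measurable_of_countable fun k : ℕ => (k : ℝ)).comp
      (measurable_playCount j)) measurable_const).inter
      (measurableSet_le measurable_const ((measurable_noiseSum ν j).const_mul σ))
  · rintro t h ⟨hT, hS⟩
    refine ENNReal.ofReal_le_ofReal (Real.exp_le_exp.2 ?_)
    have h1 : y / m * y ≤ l * noiseSum ν h j := by
      rw [hl, mul_comm σ, mul_assoc]
      gcongr
    have h2 : (y / m) ^ 2 * playCount h j ≤ (y / m) ^ 2 * m := by gcongr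
    have h3 : y ^ 2 / (2 * m) = y / m * y - (y / m) ^ 2 * m / 2 := by field_simp; ring
    rw [h3, hl2]
    linarith

/-! ### Exponential sums and deviations of the confidence bounds. -/

/-- This is `1 + v ≤ exp v` times `exp (-2v)`. At `v = 2 ^ k * c / 2` the right side telescopes in
`k`, which sums the peeling series. -/
theorem mul_exp_neg_two_mul_le (v : ℝ) :
    v * Real.exp (-(2 * v)) ≤ Real.exp (-v) - Real.exp (-(2 * v)) := by
  have h1 : Real.exp (-v) = Real.exp v * Real.exp (-(2 * v)) := by
    rw [← Real.exp_add]; ring_nf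
  rw [h1]
  nlinarith [Real.add_one_le_exp v, Real.exp_pos (-(2 * v))]

theorem sum_two_pow_mul_exp_le {c : ℝ} (hc : 0 < c) (L : ℕ) :
    ∑ k ∈ Finset.range L, 2 ^ k * Real.exp (-(2 ^ k * c)) ≤ 2 / c := by
  have hterm : ∀ k ∈ Finset.range L, (2 : ℝ) ^ k * Real.exp (-(2 ^ k * c)) ≤
      2 / c * (Real.exp (-(2 ^ k * c / 2)) - Real.exp (-(2 ^ (k + 1) * c / 2))) := by
    intro k _
    have := mul_exp_neg_two_mul_le (2 ^ k * c / 2)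
    rw [show 2 * ((2 : ℝ) ^ k * c / 2) = 2 ^ k * c by ring] at this
    rw [show (2 : ℝ) ^ (k + 1) * c / 2 = 2 ^ k * c by ring]
    calc _ = 2 / c * (2 ^ k * c / 2 * Real.exp (-(2 ^ k * c))) := by field_simp
      _ ≤ _ := by gcongr
  refine (Finset.sum_le_sum hterm).trans ?_
  rw [← Finset.mul_sum, Finset.sum_range_sub' fun k => Real.exp (-(2 ^ k * c / 2))]
  have h1 : Real.exp (-(2 ^ 0 * c / 2)) ≤ 1 := Real.exp_le_one_iff.2 (by simp; positivity)
  have h2 := Real.exp_pos (-(2 ^ L * c / 2))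
  exact mul_le_of_le_one_right (by positivity) (by linarith)

theorem sum_exp_neg_mul_le {a : ℝ} (ha : 0 < a) (n : ℕ) :
    ∑ s ∈ Finset.Icc 1 n, Real.exp (-(s * a)) ≤ 1 / a := by
  have hterm : ∀ k ∈ Finset.range n, Real.exp (-((k + 1 : ℕ) * a)) ≤
      1 / a * (Real.exp (-(k * a)) - Real.exp (-((k + 1 : ℕ) * a))) := by
    intro k _
    have h1 : Real.exp (-(k * a)) = Real.exp a * Real.exp (-((k + 1 : ℕ) * a)) := by
      rw [← Real.exp_add]; push_cast; ring_nf
    rw [one_div, inv_mul_eq_div, le_div_iff₀ ha, h1]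
    nlinarith [Real.add_one_le_exp a, Real.exp_pos (-((k + 1 : ℕ) * a))]
  rw [← Finset.Ico_add_one_right_eq_Icc, Finset.sum_Ico_eq_sum_range]
  simp only [add_tsub_cancel_right, add_comm 1]
  refine (Finset.sum_le_sum hterm).trans ?_
  rw [← Finset.mul_sum, Finset.sum_range_sub' fun k : ℕ => Real.exp (-(k * a))]
  have h2 := Real.exp_pos (-(n * a))
  exact mul_le_of_le_one_right (by positivity) (by simp; positivity)

theorem posLog_le_self {x : ℝ} (hx : 0 ≤ x) : Real.posLog x ≤ x :=
  max_le hx (Real.log_le_self hx)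

theorem playCount_le {t : ℕ} (h : History K t) (j : Fin K) : playCount h j ≤ t :=
  (Finset.card_le_univ _).trans_eq (Fintype.card_fin t)

/-- The histories after which the upper confidence bound of arm `j` with horizon `N` falls short of
its mean by at least `x`. -/
noncomputable def lowerDeviation (ν : Environment K) (j : Fin K) (N x : ℝ) (t : ℕ) :
    Set (History K t) :=
  {h | playCount h j ≠ 0 ∧ empiricalMean h j +
    √(4 / (playCount h j : ℝ) * Real.posLog (N / (playCount h j : ℝ))) ≤ ν.mean j - x}

/-- The histories with `s` plays of arm `j` after which its upper confidence bound with horizon `N`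
exceeds its mean by at least `x`. -/
noncomputable def upperDeviation (ν : Environment K) (j : Fin K) (N : ℝ) (s : ℕ) (x : ℝ) (t : ℕ) :
    Set (History K t) :=
  {h | playCount h j = s ∧
    ν.mean j + x ≤ empiricalMean h j + √(4 / (s : ℝ) * Real.posLog (N / (s : ℝ)))}

theorem measurable_confidence {t : ℕ} (j : Fin K) (N : ℝ) :
    Measurable fun h : History K t => empiricalMean h j +
      √(4 / (playCount h j : ℝ) * Real.posLog (N / (playCount h j : ℝ))) :=
  (measurable_empiricalMean j).add
    ((measurable_of_countable fun k : ℕ => √(4 / (k : ℝ) * Real.posLog (N / (k : ℝ)))).comp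
      (measurable_playCount j))

theorem measurableSet_lowerDeviation (ν : Environment K) (j : Fin K) (N x : ℝ) (t : ℕ) :
    MeasurableSet (lowerDeviation ν j N x t) :=
  ((measurable_playCount j) (measurableSet_singleton 0).compl).inter
    (measurableSet_le (measurable_confidence j N) measurable_const)

theorem measurableSet_upperDeviation (ν : Environment K) (j : Fin K) (N : ℝ) (s : ℕ) (x : ℝ)
    (t : ℕ) : MeasurableSet (upperDeviation ν j N s x t) :=
  ((measurable_playCount j) (measurableSet_singleton s)).inter
    (measurableSet_le measurable_const ((measurable_empiricalMean j).add_const _))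

theorem occurs_mono {A A' : ∀ t, Set (History K t)} {n : ℕ} (h : ∀ t ≤ n, A t ⊆ A' t) :
    occurs A n ⊆ occurs A' n :=
  fun _ ⟨t, ht, hA⟩ => ⟨t, ht, h t ht hA⟩

/-- Peel on the dyadic block `2 ^ k ≤ T < 2 ^ (k + 1)` of the play count. In each block Chernoff's
bound yields a factor `2 ^ (k + 1) / N` from the logarithm and `exp (-2 ^ k * x ^ 2 / 4)` from `x`.
-/
theorem real_occurs_lowerDeviation_le (π : Strategy K) (ν : Environment K) (n : ℕ) (j : Fin K)
    {N x : ℝ} (hN : 0 < N) (hx : 0 < x) :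
    (historyLaw π ν n).real (occurs (lowerDeviation ν j N x) n) ≤ 16 / (N * x ^ 2) := by
  -- The noise must reach `T * x + √(4 * T * posLog (N / T))` in absolute value. Dropping the cross
  -- term of its square and using the block's endpoints leaves `y k ^ 2`.
  set y : ℕ → ℝ := fun k => √((2 ^ k * x) ^ 2 + 4 * 2 ^ k * Real.posLog (N / 2 ^ (k + 1)))
  have hy : ∀ k, y k ^ 2 = (2 ^ k * x) ^ 2 + 4 * 2 ^ k * Real.posLog (N / 2 ^ (k + 1)) := fun k =>
    Real.sq_sqrt (add_nonneg (sq_nonneg _) (mul_nonneg (by positivity) Real.posLog_nonneg))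
  have hsub : occurs (lowerDeviation ν j N x) n ⊆ ⋃ k ∈ Finset.range (n + 1),
      occurs (fun _ => {h | (playCount h j : ℝ) ≤ 2 ^ (k + 1) ∧ y k ≤ -1 * noiseSum ν h j}) n := by
    rintro h ⟨t, ht, h0, hle⟩
    set h' := h.take t ht
    set T := playCount h' j
    have hTn : T ≤ n := (playCount_le h' j).trans ht
    have hlow : 2 ^ Nat.log 2 T ≤ T := Nat.pow_log_le_self 2 h0
    have hupp : T < 2 ^ (Nat.log 2 T + 1) := Nat.lt_pow_succ_log_self one_lt_two T
    have hlowR : (2 : ℝ) ^ Nat.log 2 T ≤ T := by exact_mod_cast hlow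
    have huppR : (T : ℝ) ≤ 2 ^ (Nat.log 2 T + 1) := by exact_mod_cast hupp.le
    have hT : (0 : ℝ) < T := by exact_mod_cast Nat.pos_of_ne_zero h0
    simp only [Set.mem_iUnion, Finset.mem_range]
    refine ⟨Nat.log 2 T, Nat.lt_succ_of_le ((Nat.log_le_self 2 T).trans hTn), t, ht, huppR, ?_⟩
    rw [empiricalMean_eq ν h' j h0] at hle
    have hS : T * x + √(4 * T * Real.posLog (N / T)) ≤ -1 * noiseSum ν h' j := by
      have h1 : √(4 * T * Real.posLog (N / T)) = T * √(4 / T * Real.posLog (N / T)) := by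
        rw [show 4 * T * Real.posLog (N / T) = T ^ 2 * (4 / T * Real.posLog (N / T)) by field_simp,
          Real.sqrt_mul (sq_nonneg _), Real.sqrt_sq hT.le]
      have h2 : noiseSum ν h' j = T * (noiseSum ν h' j / T) := by field_simp
      rw [h1, h2]
      nlinarith
    refine le_trans (Real.sqrt_le_iff.2 ⟨by positivity, ?_⟩) hS
    have hlog : 0 ≤ 4 * T * Real.posLog (N / T) := mul_nonneg (by positivity) Real.posLog_nonneg
    rw [add_sq, Real.sq_sqrt hlog]
    have h3 : Real.posLog (N / 2 ^ (Nat.log 2 T + 1)) ≤ Real.posLog (N / T) :=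
      Real.posLog_le_posLog (by positivity) (by gcongr)
    have h4 : 0 ≤ Real.posLog (N / 2 ^ (Nat.log 2 T + 1)) := Real.posLog_nonneg
    have h5 : (2 ^ Nat.log 2 T * x) ^ 2 ≤ (T * x) ^ 2 := by gcongr
    have h6 : 4 * 2 ^ Nat.log 2 T * Real.posLog (N / 2 ^ (Nat.log 2 T + 1)) ≤
        4 * T * Real.posLog (N / T) := by gcongr
    have h7 : 0 ≤ 2 * (T * x) * √(4 * T * Real.posLog (N / T)) := by positivity
    linarith
  refine (measureReal_mono hsub (measure_ne_top _ _)).trans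
    ((measureReal_biUnion_finset_le _ _).trans ?_)
  have hterm : ∀ k ∈ Finset.range (n + 1), (historyLaw π ν n).real (occurs
      (fun _ => {h | (playCount h j : ℝ) ≤ 2 ^ (k + 1) ∧ y k ≤ -1 * noiseSum ν h j}) n) ≤
      2 / N * (2 ^ k * Real.exp (-(2 ^ k * (x ^ 2 / 4)))) := by
    intro k _
    refine (real_occurs_noiseSum_le π ν n j (by norm_num) (by positivity)
      (Real.sqrt_nonneg _)).trans ?_
    -- The 4 in the confidence width makes the coefficient of the logarithm exactly 1 here, despite
    -- the factor 2 lost by peeling.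
    have h1 : -(y k ^ 2 / (2 * 2 ^ (k + 1))) =
        -(2 ^ k * (x ^ 2 / 4)) + -Real.posLog (N / 2 ^ (k + 1)) := by
      rw [hy]; field_simp; ring
    rw [h1, Real.exp_add]
    have h2 : Real.exp (-Real.posLog (N / 2 ^ (k + 1))) ≤ 2 / N * 2 ^ k := by
      calc _ ≤ Real.exp (-Real.log (N / 2 ^ (k + 1))) := by
            gcongr; exact le_max_right _ _
        _ = 2 / N * 2 ^ k := by
            rw [Real.exp_neg, Real.exp_log (by positivity)]; field_simp; ring
    calc _ ≤ Real.exp (-(2 ^ k * (x ^ 2 / 4))) * (2 / N * 2 ^ k) := by gcongr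
      _ = _ := by ring
  refine (Finset.sum_le_sum hterm).trans ?_
  rw [← Finset.mul_sum]
  calc _ ≤ 2 / N * (2 / (x ^ 2 / 4)) := by
        gcongr; exact sum_two_pow_mul_exp_le (by positivity) _
    _ = _ := by field_simp; ring

/-- Up to `4 * √N / x` plays, the probability is bounded by 1. Beyond that, `posLog z ≤ z` makes the
confidence width at most `x / 2`, so the average noise is at least `x / 2`, and these probabilities
are dominated by a geometric series. -/
theorem mul_sum_real_occurs_upperDeviation_le (π : Strategy K) (ν : Environment K) (n : ℕ)
    (j : Fin K) {N x : ℝ} (hN : 0 < N) (hx : 0 < x) :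
    x * ∑ s ∈ Finset.Icc 1 n, (historyLaw π ν n).real (occurs (upperDeviation ν j N s x) n) ≤
      4 * √N + 8 / x := by
  have hterm : ∀ s ∈ Finset.Icc 1 n,
      (historyLaw π ν n).real (occurs (upperDeviation ν j N s x) n) ≤
        (if (s : ℝ) ≤ 4 * √N / x then 1 else 0) + Real.exp (-(s * (x ^ 2 / 8))) := by
    intro s hs
    have hs0 : (0 : ℝ) < s := by exact_mod_cast (Finset.mem_Icc.1 hs).1
    split_ifs with hsN
    · linarith [measureReal_le_one (μ := historyLaw π ν n)
        (s := occurs (upperDeviation ν j N s x) n), Real.exp_pos (-(s * (x ^ 2 / 8)))]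
    · have hroot : √(4 / s * Real.posLog (N / s)) ≤ x / 2 := by
        refine Real.sqrt_le_iff.2 ⟨by positivity, ?_⟩
        have h1 : 4 * √N ≤ s * x := by
          rw [not_le, div_lt_iff₀ hx] at hsN
          exact hsN.le
        calc 4 / s * Real.posLog (N / s) ≤ 4 / s * (N / s) := by
              gcongr; exact posLog_le_self (by positivity)
          _ = (4 * √N) ^ 2 / (4 * s ^ 2) := by
              rw [mul_pow, Real.sq_sqrt hN.le]; field_simp
          _ ≤ (s * x) ^ 2 / (4 * s ^ 2) := by gcongr
          _ = (x / 2) ^ 2 := by field_simp; ring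
      rw [zero_add]
      have hsub : occurs (upperDeviation ν j N s x) n ⊆
          occurs (fun _ => {h | (playCount h j : ℝ) ≤ s ∧ s * (x / 2) ≤ 1 * noiseSum ν h j}) n := by
        refine occurs_mono fun t _ h hh => ⟨by rw [hh.1], ?_⟩
        obtain ⟨hT, hle⟩ := hh
        rw [empiricalMean_eq ν h j (by rw [hT]; exact_mod_cast hs0.ne'), hT] at hle
        have h2 : x / 2 ≤ noiseSum ν h j / s := by linarith
        rw [le_div_iff₀ hs0] at h2
        linarith
      refine (measureReal_mono hsub).trans ((real_occurs_noiseSum_le π ν n j (by norm_num) hs0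
        (by positivity)).trans_eq ?_)
      congr 2
      field_simp
      ring
  have hcount : ∑ s ∈ Finset.Icc 1 n, (if (s : ℝ) ≤ 4 * √N / x then (1 : ℝ) else 0) ≤
      4 * √N / x := by
    rw [← Finset.sum_filter, Finset.sum_const, nsmul_one]
    have hnn : 0 ≤ 4 * √N / x := by positivity
    refine le_trans ?_ (Nat.floor_le hnn)
    have : (Finset.Icc 1 n).filter (fun s : ℕ => (s : ℝ) ≤ 4 * √N / x) ⊆
        Finset.Icc 1 ⌊4 * √N / x⌋₊ := by
      intro s hs
      rw [Finset.mem_filter, Finset.mem_Icc] at hs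
      exact Finset.mem_Icc.2 ⟨hs.1.1, Nat.le_floor hs.2⟩
    exact_mod_cast (Finset.card_le_card this).trans_eq (by simp)
  calc _ ≤ x * (4 * √N / x + 1 / (x ^ 2 / 8)) := by
        gcongr
        refine (Finset.sum_le_sum hterm).trans ?_
        rw [Finset.sum_add_distrib]
        exact add_le_add hcount (sum_exp_neg_mul_le (by positivity) n)
    _ = _ := by field_simp

/-! ### Existence of the strategy. -/

theorem measurable_mossIndex {t : ℕ} (n : ℕ) (B : Fin K → ℝ) (i : Fin K) :
    Measurable fun h : History K t => mossIndex n B h i := by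
  unfold mossIndex
  exact .ite (measurable_playCount i (measurableSet_singleton 0)) measurable_const
    ((measurable_confidence i _).sub_const _).coe_real_ereal

theorem exists_isUnbalancedMOSS (n : ℕ) (hK : 0 < K) (B : Fin K → ℝ) :
    ∃ π : Strategy K, IsUnbalancedMOSS n B π := by
  classical
  have : Nonempty (Fin K) := ⟨⟨0, hK⟩⟩
  -- Encoding the arm as a natural number lets `Nat.find` select the least maximiser, a measurable
  -- tie-breaking rule.
  have hex : ∀ t (h : History K t),
      ∃ a : ℕ, ∃ ha : a < K, ∀ j, mossIndex n B h j ≤ mossIndex n B h ⟨a, ha⟩ := by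
    intro t h
    obtain ⟨a, ha⟩ := Finite.exists_max fun i => mossIndex n B h i
    exact ⟨a, a.2, ha⟩
  have hfind : ∀ t, Measurable fun h : History K t => Nat.find (hex t h) := by
    intro t
    refine measurable_find _ fun k => ?_
    by_cases hk : k < K
    · simp only [hk, exists_true_left]
      rw [Set.ofPred_forall]
      exact .iInter fun j => measurableSet_le (measurable_mossIndex n B j)
        (measurable_mossIndex n B _)
    · simp [hk]
  refine ⟨⟨fun t h => ⟨Nat.find (hex t h), (Nat.find_spec (hex t h)).1⟩, fun t => ?_⟩, ?_⟩
  · refine measurable_to_countable' fun a => ?_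
    convert hfind t (measurableSet_singleton (a : ℕ)) using 1
    ext h
    simp [Fin.ext_iff]
  · intro t _ h j
    exact (Nat.find_spec (hex t h)).2 j

/-! ### The pathwise regret bound. -/

theorem playCount_take {n : ℕ} (h : History K n) (j : Fin K) (t : ℕ) (ht : t ≤ n) :
    playCount (h.take t ht) j =
      (Finset.univ.filter fun s : Fin n => (h s).1 = j ∧ (s : ℕ) < t).card := by
  rw [playCount]
  refine Finset.card_bij (fun s _ => Fin.castLE ht s) ?_ ?_ ?_
  · intro s hs
    simp only [Finset.mem_filter, Finset.mem_univ, true_and] at hs ⊢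
    exact ⟨hs, s.2⟩
  · intro s _ s' _ hss
    exact Fin.castLE_injective ht hss
  · intro s hs
    simp only [Finset.mem_filter, Finset.mem_univ, true_and] at hs
    exact ⟨⟨s, hs.2⟩, Finset.mem_filter.2 ⟨Finset.mem_univ _, hs.1⟩, rfl⟩

/-- Makes the play count injective on the rounds that play `j`, so that rounds can be counted
through play counts. -/
theorem playCount_take_lt {n : ℕ} (h : History K n) {j : Fin K} {t t' : Fin n}
    (hj : (h t).1 = j) (htt : t < t') :
    playCount (h.take t t.2.le) j < playCount (h.take t' t'.2.le) j := by
  rw [playCount_take, playCount_take]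
  refine Finset.card_lt_card ((Finset.ssubset_iff_of_subset fun s hs => ?_).2 ⟨t, ?_, ?_⟩)
  · simp only [Finset.mem_filter, Finset.mem_univ, true_and] at hs ⊢
    exact ⟨hs.1, hs.2.trans htt⟩
  · simpa [hj] using htt
  · simp

/-- An upper bound on the shortfall of the upper confidence bounds of arm `i` in the history, which
is rounded up to a power of two times `b`. -/
noncomputable def shortfall (ν : Environment K) (i : Fin K) (N b : ℝ) (M n : ℕ) (h : History K n) :
    ℝ :=
  b * (1 + ∑ m ∈ Finset.range M,
    2 ^ m * (occurs (lowerDeviation ν i N (2 ^ m * b)) n).indicator (1 : History K n → ℝ) h)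

/-- The first `m` indicators equal 1, and `1 + ∑ 2 ^ k` over `k < m` is `2 ^ m`. -/
theorem le_shortfall (ν : Environment K) (i : Fin K) (N : ℝ) {b : ℝ} (hb : 0 < b) {M n : ℕ}
    (h : History K n) {m : ℕ} (hm : m ≤ M)
    (hlt : ∀ k < m, h ∈ occurs (lowerDeviation ν i N (2 ^ k * b)) n) :
    2 ^ m * b ≤ shortfall ν i N b M n h := by
  have h1 : ∑ k ∈ Finset.range m, (2 : ℝ) ^ k ≤ ∑ k ∈ Finset.range M,
      2 ^ k * (occurs (lowerDeviation ν i N (2 ^ k * b)) n).indicator (1 : History K n → ℝ) h := by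
    calc _ = ∑ k ∈ Finset.range m, 2 ^ k *
          (occurs (lowerDeviation ν i N (2 ^ k * b)) n).indicator (1 : History K n → ℝ) h := by
          refine Finset.sum_congr rfl fun k hk => ?_
          rw [Set.indicator_of_mem (hlt k (Finset.mem_range.1 hk))]
          simp
      _ ≤ _ := by
          refine Finset.sum_le_sum_of_subset_of_nonneg (Finset.range_mono hm) fun k _ _ => ?_
          exact mul_nonneg (by positivity) (Set.indicator_nonneg (fun _ _ => zero_le_one) _)
  have h2 : ∑ k ∈ Finset.range m, (2 : ℝ) ^ k = 2 ^ m - 1 := by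
    rw [geom_sum_eq (by norm_num)]; norm_num
  rw [h2] at h1
  rw [shortfall, mul_comm]
  gcongr
  linarith

/-- The upper confidence bounds of arm `i` exceed its mean minus the shortfall, unless the shortfall
is at least one. -/
theorem sub_shortfall_lt (ν : Environment K) (i : Fin K) (N : ℝ) {b : ℝ} {M n : ℕ}
    (hM : 1 ≤ 2 ^ M * b) (h : History K n) (hV : shortfall ν i N b M n h < 1) (t : ℕ) (ht : t ≤ n)
    (hT : playCount (h.take t ht) i ≠ 0) :
    ν.mean i - shortfall ν i N b M n h < empiricalMean (h.take t ht) i +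
      √(4 / (playCount (h.take t ht) i : ℝ) *
        Real.posLog (N / (playCount (h.take t ht) i : ℝ))) := by
  classical
  have hb : 0 < b := pos_of_mul_pos_right (zero_lt_one.trans_le hM) (by positivity)
  -- If all `M` scales failed, the shortfall would be at least `2 ^ M * b ≥ 1`. The least scale that
  -- does not fail then lies below the shortfall.
  have hex : ∃ m, m < M ∧ h ∉ occurs (lowerDeviation ν i N (2 ^ m * b)) n := by
    by_contra! hall
    linarith [le_shortfall ν i N hb h le_rfl hall]
  have hlt : ∀ k < Nat.find hex, h ∈ occurs (lowerDeviation ν i N (2 ^ k * b)) n := by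
    intro k hk
    by_contra hcon
    exact Nat.find_min hex hk ⟨hk.trans (Nat.find_spec hex).1, hcon⟩
  have hle := le_shortfall ν i N hb h (Nat.find_spec hex).1.le hlt
  by_contra! hcon
  exact (Nat.find_spec hex).2 ⟨t, ht, hT, by linarith⟩

/-- Gaps are at most one, so `hgap` forces the shortfall below one and the finitely many scales
suffice. The index of `i` then exceeds `ν.mean i` minus half the gap, and so does the index of the
chosen arm `j`. -/
theorem mem_upperDeviation_of_act {n : ℕ} {B : Fin K → ℝ} {π : Strategy K}
    (hπ : IsUnbalancedMOSS n B π) (ν : Environment K) {i j : Fin K} {M : ℕ}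
    (hM : 1 ≤ 2 ^ M * √(1 / armHorizon n B i)) {h : History K n}
    (hgap : 2 * (shortfall ν i (armHorizon n B i) √(1 / armHorizon n B i) M n h +
      √(1 / armHorizon n B i)) < ν.mean i - ν.mean j)
    {t : Fin n} (hact : π.act t (h.take t t.2.le) = j)
    (hT : playCount (h.take t t.2.le) j ≠ 0) :
    h.take t t.2.le ∈ upperDeviation ν j (armHorizon n B j) (playCount (h.take t t.2.le) j)
      ((ν.mean i - ν.mean j) / 2 + √(1 / armHorizon n B j)) t := by
  have hindex := hπ t t.2 (h.take t t.2.le) i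
  have hb : 0 < √(1 / armHorizon n B i) :=
    pos_of_mul_pos_right (zero_lt_one.trans_le hM) (by positivity)
  have hV0 := le_shortfall ν i (armHorizon n B i) hb h (Nat.zero_le M) (by simp)
  have hV1 : shortfall ν i (armHorizon n B i) √(1 / armHorizon n B i) M n h < 1 := by
    linarith [ν.gap_le_one i j]
  rw [hact, mossIndex, mossIndex, if_neg hT] at hindex
  split_ifs at hindex with hi
  · exact absurd (top_le_iff.1 hindex) (EReal.coe_ne_top _)
  · rw [EReal.coe_le_coe_iff] at hindex
    have hlow := sub_shortfall_lt ν i (armHorizon n B i) hM h hV1 t t.2.le hi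
    exact ⟨rfl, by linarith⟩

/-- The pathwise bound on the regret of Unbalanced MOSS. -/
theorem sum_gap_le {n : ℕ} {B : Fin K → ℝ} {π : Strategy K}
    (hπ : IsUnbalancedMOSS n B π) (ν : Environment K) (i : Fin K) {M : ℕ}
    (hM : 1 ≤ 2 ^ M * √(1 / armHorizon n B i)) {h : History K n}
    (hact : ∀ t : Fin n, (h t).1 = π.act t (h.take t t.2.le)) :
    ∑ t : Fin n, (ν.mean i - ν.mean (h t).1) ≤
      n * (2 * (shortfall ν i (armHorizon n B i) √(1 / armHorizon n B i) M n h +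
        √(1 / armHorizon n B i))) +
      ∑ j ∈ Finset.univ.erase i, max 0 (ν.mean i - ν.mean j) *
        (1 + ∑ s ∈ Finset.Icc 1 n, (occurs (upperDeviation ν j (armHorizon n B j) s
          ((ν.mean i - ν.mean j) / 2 + √(1 / armHorizon n B j))) n).indicator
            (1 : History K n → ℝ) h) := by
  classical
  set D := 2 * (shortfall ν i (armHorizon n B i) √(1 / armHorizon n B i) M n h +
        √(1 / armHorizon n B i)) with hD
  set A : Fin K → ℕ → Set (History K n) := fun j s =>
    occurs (upperDeviation ν j (armHorizon n B j) s
      ((ν.mean i - ν.mean j) / 2 + √(1 / armHorizon n B j))) n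
  have hb : 0 < √(1 / armHorizon n B i) :=
    pos_of_mul_pos_right (zero_lt_one.trans_le hM) (by positivity)
  have hV0 := le_shortfall ν i (armHorizon n B i) hb h (Nat.zero_le M) (by simp)
  have hD0 : 0 ≤ D := by rw [hD]; linarith
  have hround : ∀ t : Fin n, ν.mean i - ν.mean (h t).1 ≤ D + ∑ j ∈ Finset.univ.erase i,
      max 0 (ν.mean i - ν.mean j) * if (h t).1 = j ∧ D < ν.mean i - ν.mean j then 1 else 0 := by
    intro t
    have hnn : ∀ j ∈ Finset.univ.erase i, 0 ≤ max 0 (ν.mean i - ν.mean j) *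
        if (h t).1 = j ∧ D < ν.mean i - ν.mean j then (1 : ℝ) else 0 :=
      fun j _ => mul_nonneg (le_max_left _ _) (by split_ifs <;> norm_num)
    by_cases hbig : D < ν.mean i - ν.mean (h t).1
    · have hne : (h t).1 ≠ i := by
        intro heq
        rw [heq, sub_self] at hbig
        linarith
      have := Finset.single_le_sum hnn (Finset.mem_erase.2 ⟨hne, Finset.mem_univ _⟩)
      rw [if_pos ⟨rfl, hbig⟩, mul_one] at this
      linarith [le_max_right 0 (ν.mean i - ν.mean (h t).1)]
    · linarith [Finset.sum_nonneg hnn]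
  refine (Finset.sum_le_sum fun t _ => hround t).trans ?_
  rw [Finset.sum_add_distrib, Finset.sum_const, Finset.card_univ, Fintype.card_fin, nsmul_eq_mul,
    Finset.sum_comm]
  gcongr with j hj
  rw [← Finset.mul_sum]
  gcongr
  have hsumnn : 0 ≤ ∑ s ∈ Finset.Icc 1 n, (A j s).indicator (1 : History K n → ℝ) h :=
    Finset.sum_nonneg fun s _ => Set.indicator_nonneg (fun _ _ => zero_le_one) _
  by_cases hbig : D < ν.mean i - ν.mean j
  · simp only [hbig, and_true]
    have hcard : (Finset.univ.filter fun t : Fin n => (h t).1 = j).card ≤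
        -- The extra value 0 accounts for the first play of `j`, made with infinite index.
        (insert 0 ((Finset.Icc 1 n).filter fun s => h ∈ A j s)).card := by
      refine Finset.card_le_card_of_injOn (fun t => playCount (h.take t t.2.le) j) ?_ ?_
      · intro t ht
        rw [Finset.mem_coe, Finset.mem_filter] at ht
        rw [Finset.mem_coe, Finset.mem_insert, Finset.mem_filter, Finset.mem_Icc]
        by_cases hT : playCount (h.take t t.2.le) j = 0
        · exact .inl hT
        · exact .inr ⟨⟨Nat.one_le_iff_ne_zero.2 hT, (playCount_le _ j).trans t.2.le⟩, t, t.2.le,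
            mem_upperDeviation_of_act hπ ν hM hbig ((hact t).symm.trans ht.2) hT⟩
      · intro t ht t' ht' heq
        rw [Finset.mem_coe, Finset.mem_filter] at ht ht'
        rcases lt_trichotomy t t' with hlt | rfl | hlt
        · exact absurd heq (playCount_take_lt h ht.2 hlt).ne
        · rfl
        · exact absurd heq (playCount_take_lt h ht'.2 hlt).ne'
    have hcard' := hcard.trans (Finset.card_insert_le _ _)
    rw [Finset.sum_boole]
    calc ((Finset.univ.filter fun t : Fin n => (h t).1 = j).card : ℝ)
        ≤ ((Finset.Icc 1 n).filter fun s => h ∈ A j s).card + 1 := by exact_mod_cast hcard'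
      _ = _ := by
        rw [add_comm, ← Finset.sum_boole]
        simp only [Set.indicator_apply, Pi.one_apply, A]
  · simp only [hbig, and_false, if_false, Finset.sum_const_zero]
    linarith

/-! ### Expected regret and the frontier condition. -/

theorem integrable_mean_action (π : Strategy K) (ν : Environment K) (n : ℕ) (t : Fin n) :
    Integrable (fun h : History K n => ν.mean (h t).1) (historyLaw π ν n) := by
  obtain ⟨C, hC⟩ := (Set.finite_range fun j => ‖ν.mean j‖).bddAbove
  exact .of_bound ((measurable_of_countable ν.mean).comp
    (measurable_pi_apply t).fst).aestronglyMeasurable C (.of_forall fun h => hC ⟨_, rfl⟩)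

theorem integrable_sum_gap (π : Strategy K) (ν : Environment K) (n : ℕ) (i : Fin K) :
    Integrable (fun h : History K n => ∑ t : Fin n, (ν.mean i - ν.mean (h t).1))
      (historyLaw π ν n) :=
  integrable_finsetSum _ fun t _ => (integrable_const _).sub (integrable_mean_action π ν n t)

theorem regret_eq (n : ℕ) (π : Strategy K) (ν : Environment K) (i : Fin K) :
    regret n π ν i = ∫ h, ∑ t : Fin n, (ν.mean i - ν.mean (h t).1) ∂historyLaw π ν n := by
  simp_rw [Finset.sum_sub_distrib]
  rw [regret, integral_sub (integrable_const _)
    (integrable_finsetSum _ fun t _ => integrable_mean_action π ν n t)]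
  simp

theorem regret_le_horizon (n : ℕ) (π : Strategy K) (ν : Environment K) (i : Fin K) :
    regret n π ν i ≤ n := by
  rw [regret_eq]
  calc _ ≤ ∫ _, (n : ℝ) ∂historyLaw π ν n := by
        refine integral_mono (integrable_sum_gap π ν n i) (integrable_const _) fun h => ?_
        refine (Finset.sum_le_sum fun t _ => ν.gap_le_one i (h t).1).trans ?_
        simp
    _ = n := by simp

theorem integrable_indicator_occurs (π : Strategy K) (ν : Environment K) (n : ℕ)
    {A : ∀ t, Set (History K t)} (hA : ∀ t, MeasurableSet (A t)) :
    Integrable (fun h => (occurs A n).indicator (1 : History K n → ℝ) h) (historyLaw π ν n) :=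
  (integrable_const (1 : ℝ)).indicator (measurableSet_occurs hA n)

theorem integrable_shortfall (π : Strategy K) (ν : Environment K) (i : Fin K) (N b : ℝ)
    (M n : ℕ) : Integrable (shortfall ν i N b M n) (historyLaw π ν n) :=
  ((integrable_const _).add (integrable_finsetSum _ fun _ _ => (integrable_indicator_occurs π ν n
    (measurableSet_lowerDeviation ν i N _)).const_mul _)).const_mul b

/-- Since `N * b ^ 2 = 1` for `b = √(1 / N)`, scale `m` contributes at most `16 * 2 ^ (-m)`; hence
`33 = 1 + 16 * 2`. -/
theorem integral_shortfall_le (π : Strategy K) (ν : Environment K) (i : Fin K) {N : ℝ} (hN : 0 < N)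
    (M n : ℕ) :
    ∫ h, shortfall ν i N √(1 / N) M n h ∂historyLaw π ν n ≤ 33 * √(1 / N) := by
  have hb : 0 < √(1 / N) := by positivity
  have hb2 : √(1 / N) ^ 2 = 1 / N := Real.sq_sqrt (by positivity)
  have hint := fun m : ℕ => integrable_indicator_occurs π ν n
    (measurableSet_lowerDeviation ν i N (2 ^ m * √(1 / N)))
  simp only [shortfall]
  rw [integral_const_mul, integral_add (integrable_const _)
    (integrable_finsetSum _ fun m _ => (hint m).const_mul _),
    integral_finsetSum _ fun m _ => (hint m).const_mul _, mul_comm]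
  simp_rw [integral_const_mul, integral_indicator_one
    (measurableSet_occurs (measurableSet_lowerDeviation ν i N _) n)]
  gcongr
  have hterm : ∀ m ∈ Finset.range M, (2 : ℝ) ^ m * (historyLaw π ν n).real
      (occurs (lowerDeviation ν i N (2 ^ m * √(1 / N))) n) ≤ 16 * (1 / 2) ^ m := by
    intro m _
    have h1 := real_occurs_lowerDeviation_le π ν n i hN (x := 2 ^ m * √(1 / N)) (by positivity)
    rw [mul_pow, hb2] at h1
    calc _ ≤ (2 : ℝ) ^ m * (16 / (N * ((2 ^ m) ^ 2 * (1 / N)))) := by gcongr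
      _ = _ := by rw [one_div_pow]; field_simp
  have hgeom : ∑ m ∈ Finset.range M, (1 / 2 : ℝ) ^ m ≤ 2 := by
    have : (0 : ℝ) < (1 / 2) ^ M := by positivity
    rw [geom_sum_eq (by norm_num), div_le_iff_of_neg (by norm_num)]
    linarith
  have := Finset.sum_le_sum hterm
  rw [← Finset.mul_sum] at this
  simp only [integral_const, probReal_univ, smul_eq_mul, mul_one]
  linarith

/-- The constants are `68 = 2 * (33 + 1)` and `24 = 2 * (4 + 8)`. The summand 1 pays for the first
play of each other arm, whose gap is at most one. -/
theorem regret_le_sum {n : ℕ} {B : Fin K → ℝ} {π : Strategy K} (hπ : IsUnbalancedMOSS n B π)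
    (ν : Environment K) (i : Fin K) (hN : ∀ j, 0 < armHorizon n B j) :
    regret n π ν i ≤ n * (68 * √(1 / armHorizon n B i)) +
      ∑ j ∈ Finset.univ.erase i, (1 + 24 * √(armHorizon n B j)) := by
  set b := √(1 / armHorizon n B i) with hbdef
  have hb : 0 < b := Real.sqrt_pos.2 (one_div_pos.2 (hN i))
  obtain ⟨M, hM⟩ : ∃ M : ℕ, 1 ≤ 2 ^ M * b := by
    obtain ⟨M, hM⟩ := pow_unbounded_of_one_lt (1 / b) one_lt_two
    exact ⟨M, by rw [div_lt_iff₀ hb] at hM; exact hM.le⟩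
  have hind := fun j s => integrable_indicator_occurs π ν n (measurableSet_upperDeviation ν j
    (armHorizon n B j) s ((ν.mean i - ν.mean j) / 2 + √(1 / armHorizon n B j)))
  have hI1 : Integrable (fun h => (n : ℝ) * (2 * (shortfall ν i (armHorizon n B i) b M n h + b)))
      (historyLaw π ν n) :=
    (((integrable_shortfall π ν i _ b M n).add (integrable_const b)).const_mul 2).const_mul _
  have hI3 : ∀ j, Integrable (fun h => ∑ s ∈ Finset.Icc 1 n,
      (occurs (upperDeviation ν j (armHorizon n B j) s
        ((ν.mean i - ν.mean j) / 2 + √(1 / armHorizon n B j))) n).indicator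
          (1 : History K n → ℝ) h) (historyLaw π ν n) :=
    fun j => integrable_finsetSum _ fun s _ => hind j s
  have hI2 : ∀ j, Integrable (fun h => max 0 (ν.mean i - ν.mean j) *
      (1 + ∑ s ∈ Finset.Icc 1 n, (occurs (upperDeviation ν j (armHorizon n B j) s
        ((ν.mean i - ν.mean j) / 2 + √(1 / armHorizon n B j))) n).indicator
          (1 : History K n → ℝ) h)) (historyLaw π ν n) :=
    fun j => ((integrable_const _).add (hI3 j)).const_mul _
  rw [regret_eq]
  refine (integral_mono_ae (integrable_sum_gap π ν n i)
    (hI1.add (integrable_finsetSum (Finset.univ.erase i) fun j _ => hI2 j)) ?_).trans ?_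
  · filter_upwards [ae_act_take π ν n] with h hh
    exact sum_gap_le hπ ν i hM hh
  simp only [Pi.add_apply]
  rw [integral_add hI1 (integrable_finsetSum (Finset.univ.erase i) fun j _ => hI2 j),
    integral_finsetSum _ fun j _ => hI2 j]
  refine add_le_add ?_ (Finset.sum_le_sum fun j _ => ?_)
  · rw [integral_const_mul, integral_const_mul,
      integral_add (integrable_shortfall π ν i _ b M n) (integrable_const b)]
    have := integral_shortfall_le π ν i (hN i) M n
    simp only [integral_const, probReal_univ, smul_eq_mul, one_mul]
    refine mul_le_mul_of_nonneg_left ?_ (Nat.cast_nonneg n)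
    linarith
  · rw [integral_const_mul, integral_add (integrable_const _) (hI3 j),
      integral_finsetSum _ fun s _ => hind j s]
    simp_rw [integral_indicator_one
      (measurableSet_occurs (measurableSet_upperDeviation ν j _ _ _) n)]
    simp only [integral_const, probReal_univ, smul_eq_mul, mul_one]
    rcases le_or_gt (ν.mean i - ν.mean j) 0 with hneg | hpos
    · rw [max_eq_left hneg, zero_mul]
      positivity
    rw [max_eq_right hpos.le]
    have hbj : 0 < √(1 / armHorizon n B j) := Real.sqrt_pos.2 (one_div_pos.2 (hN j))
    set x := (ν.mean i - ν.mean j) / 2 + √(1 / armHorizon n B j) with hx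
    have hxb : √(1 / armHorizon n B j) ≤ x := by linarith
    have hsum := mul_sum_real_occurs_upperDeviation_le π ν n j (hN j) (hbj.trans_le hxb)
    have hinv : 8 / x ≤ 8 * √(armHorizon n B j) := by
      calc 8 / x ≤ 8 / √(1 / armHorizon n B j) := by gcongr
        _ = _ := by rw [one_div, Real.sqrt_inv, div_inv_eq_mul]
    have hnn : 0 ≤ ∑ s ∈ Finset.Icc 1 n,
        (historyLaw π ν n).real (occurs (upperDeviation ν j (armHorizon n B j) s x) n) :=
      Finset.sum_nonneg fun _ _ => measureReal_nonneg
    have hgap : ν.mean i - ν.mean j ≤ 2 * x := by linarith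
    have := mul_le_mul_of_nonneg_right hgap hnn
    linarith [ν.gap_le_one i j]

theorem regret_le {n : ℕ} {B : Fin K → ℝ} (hB : B ∈ frontierSet n K) {π : Strategy K}
    (hπ : IsUnbalancedMOSS n B π) (ν : Environment K) (i : Fin K) :
    regret n π ν i ≤ 252 * B i := by
  obtain ⟨hIcc, hmin⟩ := hB
  -- If `B i = n`, which includes `n = 0`, the trivial bound `n` is enough.
  rcases (hIcc i).2.eq_or_lt with heq | hlt
  · have hn : (0 : ℝ) ≤ n := Nat.cast_nonneg n
    linarith [regret_le_horizon n π ν i]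
  have hn : (0 : ℝ) < n := (hIcc i).1.trans_lt hlt
  have hn0 : (n : ℝ≥0∞) ≠ 0 := by
    have : n ≠ 0 := by rintro rfl; simp at hn
    exact_mod_cast this
  have hsum : ∑ j ∈ Finset.univ.erase i, (n : ℝ≥0∞) / ENNReal.ofReal (B j) ≤
      ENNReal.ofReal (B i) := by
    refine (min_le_iff.1 (hmin i)).resolve_left (not_le.2 ?_)
    rw [← ENNReal.ofReal_natCast]
    exact (ENNReal.ofReal_lt_ofReal_iff hn).2 hlt
  have hBj : ∀ j ≠ i, 0 < B j := by
    intro j hj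
    by_contra hcon
    have h1 := (Finset.single_le_sum (f := fun j => (n : ℝ≥0∞) / ENNReal.ofReal (B j))
      (fun _ _ => zero_le) (Finset.mem_erase.2 ⟨hj, Finset.mem_univ j⟩)).trans hsum
    rw [ENNReal.ofReal_of_nonpos (not_lt.1 hcon), ENNReal.div_zero hn0] at h1
    exact ENNReal.ofReal_ne_top (top_le_iff.1 h1)
  have hsumR : ∑ j ∈ Finset.univ.erase i, n / B j ≤ B i := by
    rw [← ENNReal.ofReal_le_ofReal_iff (hIcc i).1, ENNReal.ofReal_sum_of_nonneg
      fun j _ => div_nonneg hn.le (hIcc j).1]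
    refine le_of_eq_of_le (Finset.sum_congr rfl fun j hj => ?_) hsum
    rw [ENNReal.ofReal_div_of_pos (hBj j (Finset.ne_of_mem_erase hj)), ENNReal.ofReal_natCast]
  -- If `B i = 0`, the sum of the positive terms `n / B j` must be empty, so `i` is the only arm and
  -- its regret vanishes.
  rcases (hIcc i).1.eq_or_lt with hzero | hpos
  · have hall : ∀ j, j = i := by
      by_contra! hcon
      obtain ⟨j, hj⟩ := hcon
      have h1 := (Finset.single_le_sum (f := fun j => n / B j)
        (fun j _ => div_nonneg hn.le (hIcc j).1)
        (Finset.mem_erase.2 ⟨hj, Finset.mem_univ j⟩)).trans hsumR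
      have h2 : 0 < n / B j := div_pos hn (hBj j hj)
      linarith
    rw [regret_eq, ← hzero]
    simp [fun j => hall j]
  have hBpos : ∀ j, 0 < B j := by
    intro j
    rcases eq_or_ne j i with rfl | hj
    · exact hpos
    · exact hBj j hj
  have hN : ∀ j, armHorizon n B j = (n / B j) ^ 2 := fun j => (div_pow _ _ _).symm
  have hNpos : ∀ j, 0 < armHorizon n B j := by
    intro j
    have := hBpos j
    rw [hN]
    positivity
  have hroot : ∀ j, √(armHorizon n B j) = n / B j := fun j => by
    rw [hN, Real.sqrt_sq (div_nonneg hn.le (hBpos j).le)]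
  refine (regret_le_sum hπ ν i hNpos).trans ?_
  have h1 : (n : ℝ) * (68 * √(1 / armHorizon n B i)) = 68 * B i := by
    rw [one_div, Real.sqrt_inv, hroot]
    field_simp
  -- As `B j ≤ n`, the 1 is absorbed into `n / B j`. The total is then `(68 + 25) * B i`, well
  -- within the claimed constant.
  have h2 : ∑ j ∈ Finset.univ.erase i, (1 + 24 * √(armHorizon n B j)) ≤
      25 * ∑ j ∈ Finset.univ.erase i, n / B j := by
    rw [Finset.mul_sum]
    refine Finset.sum_le_sum fun j _ => ?_
    have : 1 ≤ n / B j := (one_le_div (hBpos j)).2 (hIcc j).2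
    rw [hroot]
    linarith
  linarith

end Bandit

theorem theorem2 (n K : ℕ) (hK : 0 < K) (B : Fin K → ℝ) (hB : B ∈ Bandit.frontierSet n K) :
    (∃ π : Bandit.Strategy K, Bandit.IsUnbalancedMOSS n B π) ∧
      ∀ π : Bandit.Strategy K, Bandit.IsUnbalancedMOSS n B π →
        ∀ i : Fin K, Bandit.worstCaseRegret n π i ≤ ((252 * B i : ℝ) : EReal) :=
  ⟨Bandit.exists_isUnbalancedMOSS n hK B, fun _ hπ i =>
    iSup_le fun ν => EReal.coe_le_coe_iff.2 (Bandit.regret_le hB hπ ν i)⟩
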